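/- Let $(\Omega,\mu)$ be a $\sigma$-finite measure space with $\mu$ non-atomic. Functions on $\Omega$ are real- or complex-valued measurable functions, identified if they agree $\mu$-almost everywhere, and $f^*(t)=\inf\{s\ge 0:\mu\{|f|>s\}\le t\}$, $t>0$, is the non-increasing rearrangement of $f$. Write $\|\cdot\|_{q,(0,\infty)}$ for the (quasi-)norm of the Lebesgue space $L_q(0,\infty)$, $0<q\le\infty$, and put $1/\infty=0$, $1/0=\infty$. A positive Lebesgue measurable function $b$ on $(0,\infty)$ is called slowly varying, $b\in SV$, if for every $\varepsilon>0$ the function $t^{\varepsilon}b(t)$ is equivalent to a non-decreasing function and $t^{-\varepsilon}b(t)$ is equivalent to a non-increasing function on $(0,\infty)$ (two functions being equivalent if each is at most a constant times the other). For $0<p,q\le\infty$ and $a\in SV$ the Lorentz–Karamata space $L_{p,q;a}$ is the set of all measurable $f$ on $\Omega$ with $$\|f\|_{p,q;a}=\big\|t^{\frac1p-\frac1q}a(t)f^*(t)\big\|_{q,(0,\infty)}<\infty ;$$ in particular $L_{p,\infty}=L_{p,\infty;1}$ is the weak Lebesgue space. $L_p$ $(0<p\le\infty)$ is the Lebesgue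 space $L_p(\Omega,\mu)$. For a couple $(A_0,A_1)$ of such spaces and $f\in A_0+A_1$ let $$K(t,f;A_0,A_1)=\inf\{\|f_0\|_{A_0}+t\|f_1\|_{A_1}: f=f_0+f_1,\ f_i\in A_i,\ i=0,1\},\qquad t>0,$$ and, for $0\le\theta\le1$, $0<q\le\infty$ and $a\in SV$, let $(A_0,A_1)_{\theta,q;a}$ be the set of all $f\in A_0+A_1$ with $$\|f\|_{\theta,q;a}=\big\|t^{-\theta-\frac1q}a(t)K(t,f;A_0,A_1)\big\|_{q,(0,\infty)}<\infty .$$ **Theorem.** Let $0<\theta\le1$, $0<\varkappa<\infty$, $p=\frac{\varkappa}{1-\theta}$ (so $p=\infty$ if $\theta=1$), $0<q\le\infty$ and $b\in SV$, and let $\tilde b(t)=b(t^{1/\varkappa})$, $t>0$. Then $$(L_\varkappa,L_\infty)_{\theta,q;b}=(L_{\varkappa,\infty},L_\infty)_{\theta,q;b}=L_{p,q;\tilde b}.$$ Here equality of two spaces means that they consist of the same functions and that their quasi-norms are equivalent, that is, each is at most a constant, not depending on the function, times the other. -/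

import Mathlib

open MeasureTheory Set
open scoped ENNReal NNReal

noncomputable section

namespace LorentzKaramata

/-- A measure is non-atomic if every measurable set of positive measure contains a measurable
subset of strictly smaller positive measure. -/
def NonAtomic {Ω : Type*} [MeasurableSpace Ω] (μ : Measure Ω) : Prop :=
  ∀ A : Set Ω, MeasurableSet A → 0 < μ A →
    ∃ B : Set Ω, B ⊆ A ∧ MeasurableSet B ∧ 0 < μ B ∧ μ B < μ A

/-- `f ≈ g` on `(0, ∞)`: each of the two functions is bounded by a constant times the other. -/
def EquivOnPos (f g : ℝ → ℝ) : Prop :=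
  ∃ C : ℝ, 0 < C ∧ ∀ t : ℝ, 0 < t → f t ≤ C * g t ∧ g t ≤ C * f t

/-- Slowly varying functions on `(0, ∞)`; values of `b` outside `(0, ∞)` are irrelevant. -/
structure SlowlyVarying (b : ℝ → ℝ) : Prop where
  aemeasurable : AEMeasurable b (volume.restrict (Ioi 0))
  pos : ∀ t : ℝ, 0 < t → 0 < b t
  increasing : ∀ ε : ℝ, 0 < ε →
    ∃ g : ℝ → ℝ, MonotoneOn g (Ioi 0) ∧ EquivOnPos (fun t => t ^ ε * b t) g
  decreasing : ∀ ε : ℝ, 0 < ε →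
    ∃ g : ℝ → ℝ, AntitoneOn g (Ioi 0) ∧ EquivOnPos (fun t => t ^ (-ε) * b t) g

/-- `‖ t ^ (r - 1/q) * a t * φ t ‖` in `L_q(0, ∞)`, with `1/∞ = 0`. -/
def weightedNorm (r : ℝ) (q : ℝ≥0∞) (a : ℝ → ℝ) (φ : ℝ → ℝ≥0∞) : ℝ≥0∞ :=
  eLpNorm (fun t : ℝ => ENNReal.ofReal (t ^ (r - (q⁻¹).toReal) * a t) * φ t) q
    (volume.restrict (Ioi 0))

/-- A subset of `X` together with its (quasi-)norm, recorded as a functional on all of `X`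
whose values outside the subset are irrelevant. -/
structure Space (X : Type*) where
  carrier : Set X
  qnorm : X → ℝ≥0∞

namespace Space

variable {X : Type*}

/-- The space of all elements at which a given extended-valued functional is finite. -/
def ofNorm (N : X → ℝ≥0∞) : Space X where
  carrier := {f | N f < ∞}
  qnorm := N

/-- Continuous embedding `A ⊂ B`. -/
def Embeds (A B : Space X) : Prop :=
  A.carrier ⊆ B.carrier ∧ ∃ C : ℝ≥0, ∀ f ∈ A.carrier, B.qnorm f ≤ C * A.qnorm f

/-- Equality of spaces: continuous embeddings in both directions, that is, the same elements
and equivalent quasi-norms. -/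
def Same (A B : Space X) : Prop :=
  A.Embeds B ∧ B.Embeds A

/-- The Peetre `K`-functional of a couple. -/
def K [Add X] (A₀ A₁ : Space X) (t : ℝ) (f : X) : ℝ≥0∞ :=
  ⨅ (f₀ ∈ A₀.carrier) (f₁ ∈ A₁.carrier) (_ : f = f₀ + f₁),
    A₀.qnorm f₀ + ENNReal.ofReal t * A₁.qnorm f₁

/-- The quasi-norm of `(A₀, A₁)_{θ,q;a}`. -/
def interpNorm [Add X] (A₀ A₁ : Space X) (θ : ℝ) (q : ℝ≥0∞) (a : ℝ → ℝ) (f : X) : ℝ≥0∞ :=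
  weightedNorm (-θ) q a (fun t => K A₀ A₁ t f)

/-- The real interpolation space `(A₀, A₁)_{θ,q;a}`: all `f ∈ A₀ + A₁` with
`‖ t ^ (-θ - 1/q) * a t * K(t, f) ‖_{q,(0,∞)} < ∞`. -/
def interp [Add X] (A₀ A₁ : Space X) (θ : ℝ) (q : ℝ≥0∞) (a : ℝ → ℝ) : Space X where
  carrier := {f | (∃ f₀ ∈ A₀.carrier, ∃ f₁ ∈ A₁.carrier, f = f₀ + f₁) ∧
    interpNorm A₀ A₁ θ q a f < ∞}
  qnorm := interpNorm A₀ A₁ θ q a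

end Space

/-- The non-increasing rearrangement `f*(t) = inf {s ≥ 0 : μ {|f| > s} ≤ t}`, `t > 0`. -/
def rearrangement {Ω 𝕜 : Type*} [RCLike 𝕜] [MeasurableSpace Ω] {μ : Measure Ω}
    (f : Ω →ₘ[μ] 𝕜) (t : ℝ) : ℝ≥0∞ :=
  sInf {s : ℝ≥0∞ | μ {x | s < ‖f x‖ₑ} ≤ ENNReal.ofReal t}

/-- The Lebesgue space `L_r(Ω, μ)`, `0 < r ≤ ∞`. -/
def lebesgueSpace (𝕜 : Type*) [RCLike 𝕜] {Ω : Type*} [MeasurableSpace Ω] (μ : Measure Ω)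
    (r : ℝ≥0∞) : Space (Ω →ₘ[μ] 𝕜) :=
  Space.ofNorm fun f => eLpNorm f r μ

/-- The Lorentz–Karamata space `L_{p,q;a}(Ω, μ)`: all measurable `f` with
`‖ t ^ (1/p - 1/q) * a t * f*(t) ‖_{q,(0,∞)} < ∞`, where `1/∞ = 0`. -/
def lorentzKaramata (𝕜 : Type*) [RCLike 𝕜] {Ω : Type*} [MeasurableSpace Ω] (μ : Measure Ω)
    (p q : ℝ≥0∞) (a : ℝ → ℝ) : Space (Ω →ₘ[μ] 𝕜) :=
  Space.ofNorm fun f => weightedNorm (p⁻¹).toReal q a (rearrangement f)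

/-- The Lorentz space `L_{p,q}(Ω, μ)`; for `q = ∞` this is the weak Lebesgue space. -/
def lorentzSpace (𝕜 : Type*) [RCLike 𝕜] {Ω : Type*} [MeasurableSpace Ω] (μ : Measure Ω)
    (p q : ℝ≥0∞) : Space (Ω →ₘ[μ] 𝕜) :=
  lorentzKaramata 𝕜 μ p q fun _ => 1

end LorentzKaramata

end

/-!
Both inclusions compare `K(t, f)` with `t f*(t ^ κ)`, whose weighted norm is, after the substitution
`t ↦ t ^ κ`, the Lorentz–Karamata quasi-norm. Splitting off a bounded function changes `f*` by at
most its supremum, so `t f*(t ^ κ) ≤ K(t, f; L_{κ,∞}, L_∞)`. Conversely, truncate `f` at the level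
`f*(t ^ κ)` and cut what is above it into the layers between the levels `f*((2⁻ʲ t) ^ κ)`: this
bounds `K(t, f; L_κ, L_∞)` by an `ℓ_κ`-sum of the dilates `2⁻ʲ t f*((2⁻ʲ⁻¹ t) ^ κ)`. In the weighted
norm the dilates decay like `2 ^ (-j (θ - ε))`, because `dt/t` is dilation invariant and
`b (l t) ≲ l ^ ε b t` for `l ≥ 1`; this works for all `q` at once, without Hardy's inequality. The
embedding `L_κ ⊂ L_{κ,∞}` closes the cycle.
-/

noncomputable section

namespace LorentzKaramata

section GeneralMeasure

variable {α : Type*} [MeasurableSpace α] {ν : Measure α}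

theorem exists_lt_top_of_eLpNorm_lt_top [NeZero ν] {q : ℝ≥0∞} (hq : q ≠ 0) {G : α → ℝ≥0∞}
    (h : eLpNorm G q ν < ∞) : ∃ x, G x < ∞ := by
  by_contra! hG
  have hG : G = fun _ => ∞ := funext fun x => top_le_iff.1 (hG x)
  refine h.ne ?_
  rw [hG, eLpNorm_const _ hq (NeZero.ne ν), enorm_eq_self, ENNReal.top_mul]
  simp [NeZero.ne ν]

theorem tsum_rpow_pow_ne_top {ρ : ℝ≥0∞} (hρ : ρ < 1) {s : ℝ} (hs : 0 < s) :
    ∑' j : ℕ, (ρ ^ j) ^ s ≠ ∞ := by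
  simp only [← ENNReal.rpow_natCast_mul, mul_comm _ s, ENNReal.rpow_mul_natCast]
  rw [ENNReal.tsum_geometric]
  simpa [tsub_eq_zero_iff_le] using ENNReal.rpow_lt_one hρ hs

theorem tsum_rpow_le_of_le_pow_mul {ρ S : ℝ≥0∞} {s : ℝ} (hs : 0 ≤ s) {a : ℕ → ℝ≥0∞}
    (h : ∀ j, a j ≤ ρ ^ j * S) : ∑' j, a j ^ s ≤ (∑' j : ℕ, (ρ ^ j) ^ s) * S ^ s := by
  rw [← ENNReal.tsum_mul_right]
  refine ENNReal.tsum_le_tsum fun j => ?_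
  rw [← ENNReal.mul_rpow_of_nonneg _ _ hs]
  exact ENNReal.rpow_le_rpow (h j) hs

theorem lintegral_iSup_pow_mul_rpow_le {s : ℝ} (hs : 0 < s) (ρ : ℝ≥0∞) {F : ℕ → α → ℝ≥0∞}
    (hF : ∀ j, AEMeasurable (F j) ν) {M : ℝ≥0∞} (hM : ∀ j, ∫⁻ x, F j x ^ s ∂ν ≤ M) :
    ∫⁻ x, (⨆ j, ρ ^ j * F j x) ^ s ∂ν ≤ (∑' j : ℕ, (ρ ^ j) ^ s) * M :=
  calc ∫⁻ x, (⨆ j, ρ ^ j * F j x) ^ s ∂ν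
      ≤ ∫⁻ x, ∑' j, (ρ ^ j) ^ s * F j x ^ s ∂ν := by
        refine lintegral_mono fun x => ?_
        rw [(ENNReal.monotone_rpow_of_nonneg hs.le).map_iSup_of_continuousAt
          ENNReal.continuous_rpow_const.continuousAt (by simpa using hs)]
        refine iSup_le fun j => ?_
        rw [ENNReal.mul_rpow_of_nonneg _ _ hs.le]
        exact ENNReal.le_tsum j
    _ = ∑' j, (ρ ^ j) ^ s * ∫⁻ x, F j x ^ s ∂ν := by
        rw [lintegral_tsum fun j => ((hF j).pow_const s).const_mul _]
        exact tsum_congr fun j => lintegral_const_mul'' _ ((hF j).pow_const s)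
    _ ≤ (∑' j : ℕ, (ρ ^ j) ^ s) * M := by
        rw [← ENNReal.tsum_mul_right]
        exact ENNReal.tsum_le_tsum fun j => mul_le_mul_right (hM j) _

theorem eLpNorm_iSup_pow_mul_le {ρ : ℝ≥0∞} (hρ : ρ < 1) (q : ℝ≥0∞) :
    ∃ C : ℝ≥0, ∀ (F : ℕ → α → ℝ≥0∞) (N : ℝ≥0∞), (∀ j, AEMeasurable (F j) ν) →
      (∀ j, eLpNorm (F j) q ν ≤ N) → eLpNorm (fun x => ⨆ j, ρ ^ j * F j x) q ν ≤ C * N := by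
  rcases eq_or_ne q 0 with rfl | hq
  · exact ⟨0, by simp⟩
  rcases eq_or_ne q ∞ with rfl | hq'
  · refine ⟨1, fun F N _ hN => ?_⟩
    rw [ENNReal.coe_one, one_mul, eLpNorm_exponent_top]
    refine essSup_le_of_ae_le _ ?_
    filter_upwards [ae_all_iff.2 fun j => ae_le_eLpNormEssSup (f := F j) (μ := ν)] with x hx
    refine iSup_le fun j => (mul_le_of_le_one_left' (pow_le_one' hρ.le j)).trans ?_
    exact (hx j).trans (hN j)
  have hs := ENNReal.toReal_pos hq hq'
  set s := q.toReal
  have hD := tsum_rpow_pow_ne_top hρ hs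
  refine ⟨((∑' j : ℕ, (ρ ^ j) ^ s) ^ (1 / s)).toNNReal, fun F N hF hN => ?_⟩
  have hN' (j : ℕ) : ∫⁻ x, F j x ^ s ∂ν ≤ N ^ s := by
    have h := ENNReal.rpow_le_rpow (hN j) hs.le
    rwa [eLpNorm_eq_lintegral_rpow_enorm_toReal hq hq', ← ENNReal.rpow_mul,
      one_div_mul_cancel hs.ne', ENNReal.rpow_one] at h
  rw [ENNReal.coe_toNNReal (ENNReal.rpow_ne_top_of_nonneg (by positivity) hD),
    eLpNorm_eq_lintegral_rpow_enorm_toReal hq hq',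
    one_div, ENNReal.rpow_inv_le_iff hs, ENNReal.mul_rpow_of_nonneg _ _ hs.le,
    ENNReal.rpow_inv_rpow hs.ne']
  exact lintegral_iSup_pow_mul_rpow_le hs ρ hF hN'

theorem setLIntegral_rpow_le_tsum_superlevel {g : α → ℝ≥0∞} (hg : Measurable g) {s : ℝ}
    (hs : 0 ≤ s) {l : ℕ → ℝ≥0∞} (hl : ν {x | ∀ j, l j < g x} = 0) :
    ∫⁻ x in {x | l 0 < g x}, g x ^ s ∂ν ≤ ∑' j, l (j + 1) ^ s * ν {x | l j < g x} := by
  have hcover : ∀ᵐ x ∂ν, x ∈ {x | l 0 < g x} → x ∈ ⋃ j, {x | l j < g x ∧ g x ≤ l (j + 1)} := by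
    filter_upwards [measure_eq_zero_iff_ae_notMem.1 hl] with x hx hx₀
    by_contra hlayer
    simp only [mem_iUnion, mem_ofPred_eq, not_exists, not_and, not_le] at hlayer
    exact hx fun j => j.rec hx₀ hlayer
  calc _ ≤ ∫⁻ x in ⋃ j, {x | l j < g x ∧ g x ≤ l (j + 1)}, g x ^ s ∂ν :=
        lintegral_mono_set' hcover
    _ ≤ ∑' j, ∫⁻ x in {x | l j < g x ∧ g x ≤ l (j + 1)}, g x ^ s ∂ν := lintegral_iUnion_le _ _
    _ ≤ _ := ENNReal.tsum_le_tsum fun j => ?_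
  have hlayer : MeasurableSet {x | l j < g x ∧ g x ≤ l (j + 1)} :=
    (measurableSet_lt measurable_const hg).inter (measurableSet_le hg measurable_const)
  calc _ ≤ ∫⁻ _ in {x | l j < g x ∧ g x ≤ l (j + 1)}, l (j + 1) ^ s ∂ν :=
        setLIntegral_mono' hlayer fun x hx => ENNReal.rpow_le_rpow hx.2 hs
    _ = l (j + 1) ^ s * ν {x | l j < g x ∧ g x ≤ l (j + 1)} := setLIntegral_const _ _
    _ ≤ _ := mul_le_mul_right (measure_mono fun x hx => hx.1) _

end GeneralMeasure

section HaarNorm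

/-- The norm of `L_q((0, ∞), dt/t)`. It is computed in the variable `u = log t`, in which `dt/t`
is Lebesgue measure, dilations are translations and powers are dilations. -/
def haarNorm (q : ℝ≥0∞) (H : ℝ → ℝ≥0∞) : ℝ≥0∞ :=
  eLpNorm (fun u => H (Real.exp u)) q volume

theorem map_exp_withDensity_exp :
    (volume.withDensity fun u => ENNReal.ofReal (Real.exp u)).map Real.exp =
      volume.restrict (Ioi 0) := by
  ext s hs
  have hs' : MeasurableSet (Real.exp ⁻¹' s) := Real.measurable_exp hs
  have h := lintegral_image_eq_lintegral_abs_deriv_mul hs'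
    (fun u _ => (Real.hasDerivAt_exp u).hasDerivWithinAt) Real.exp_injective.injOn 1
  rw [Measure.map_apply Real.measurable_exp hs, withDensity_apply _ hs',
    Measure.restrict_apply hs, ← Real.range_exp, ← image_preimage_eq_inter_range]
  simpa using h.symm

theorem quasiMeasurePreserving_exp :
    Measure.QuasiMeasurePreserving Real.exp volume (volume.restrict (Ioi 0)) := by
  refine ⟨Real.measurable_exp, ?_⟩
  rw [← map_exp_withDensity_exp]
  exact (withDensity_absolutelyContinuous' (by fun_prop) (by simp [Real.exp_pos])).map
    Real.measurable_exp

theorem eLpNorm_withDensity_exp (q : ℝ≥0∞) (G : ℝ → ℝ≥0∞) :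
    eLpNorm G q (volume.withDensity fun u => ENNReal.ofReal (Real.exp u)) =
      eLpNorm (fun u => ENNReal.ofReal (Real.exp u ^ (q⁻¹).toReal) * G u) q volume := by
  rcases eq_or_ne q 0 with rfl | hq
  · simp
  rcases eq_or_ne q ∞ with rfl | hq'
  · simp only [eLpNorm_exponent_top, ENNReal.inv_top, ENNReal.toReal_zero, Real.rpow_zero,
      ENNReal.ofReal_one, one_mul]
    refine le_antisymm (essSup_mono_measure (withDensity_absolutelyContinuous _ _))
      (essSup_mono_measure (withDensity_absolutelyContinuous' (by fun_prop) ?_))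
    simp [Real.exp_pos]
  have hs := ENNReal.toReal_pos hq hq'
  rw [eLpNorm_eq_lintegral_rpow_enorm_toReal hq hq', eLpNorm_eq_lintegral_rpow_enorm_toReal hq hq',
    lintegral_withDensity_eq_lintegral_mul_non_measurable _ (by fun_prop) (by simp)]
  congr 1
  refine lintegral_congr fun u => ?_
  rw [enorm_eq_self, ENNReal.mul_rpow_of_nonneg _ _ hs.le,
    ENNReal.ofReal_rpow_of_nonneg (by positivity) hs.le, ENNReal.toReal_inv,
    Real.rpow_inv_rpow (Real.exp_pos u).le hs.ne']
  rfl

theorem weightedNorm_eq_haarNorm (r : ℝ) (q : ℝ≥0∞) (a : ℝ → ℝ) (φ : ℝ → ℝ≥0∞) :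
    weightedNorm r q a φ = haarNorm q fun t => ENNReal.ofReal (t ^ r * a t) * φ t := by
  rw [weightedNorm, ← map_exp_withDensity_exp,
    Real.isOpenEmbedding_exp.measurableEmbedding.eLpNorm_map_measure, eLpNorm_withDensity_exp,
    haarNorm]
  congr 1 with u
  have hu := Real.exp_pos u
  rw [Function.comp_apply, ← mul_assoc, ← ENNReal.ofReal_mul (by positivity), ← mul_assoc,
    ← Real.rpow_add hu, add_sub_cancel]

theorem haarNorm_le_mul_of_le {q : ℝ≥0∞} {G H : ℝ → ℝ≥0∞} {C : ℝ≥0}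
    (h : ∀ t, 0 < t → G t ≤ C * H t) : haarNorm q G ≤ C * haarNorm q H :=
  eLpNorm_le_mul_eLpNorm_of_ae_le_mul' (.of_forall fun u => by simpa using h _ u.exp_pos) q

theorem haarNorm_congr {q : ℝ≥0∞} {G H : ℝ → ℝ≥0∞} (h : ∀ t, 0 < t → G t = H t) :
    haarNorm q G = haarNorm q H := by
  rw [haarNorm, haarNorm, funext fun u => h _ u.exp_pos]

theorem haarNorm_comp_const_mul {c : ℝ} (hc : 0 < c) (q : ℝ≥0∞) (H : ℝ → ℝ≥0∞) :
    haarNorm q (fun t => H (c * t)) = haarNorm q H := by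
  have h := (MeasurableEquiv.addLeft (Real.log c)).measurableEmbedding.eLpNorm_map_measure
    (μ := volume) (p := q) (g := fun u => H (Real.exp u))
  rw [MeasurableEquiv.coe_addLeft, map_add_left_eq_self] at h
  rw [haarNorm, haarNorm, h]
  simp only [Function.comp_def, Real.exp_add, Real.exp_log hc]

theorem haarNorm_comp_rpow {k : ℝ} (hk : 0 < k) (q : ℝ≥0∞) (H : ℝ → ℝ≥0∞) :
    haarNorm q H = ENNReal.ofReal k ^ (q⁻¹).toReal * haarNorm q (fun t => H (t ^ k)) := by
  have hvol : ENNReal.ofReal k • Measure.map (MeasurableEquiv.mulLeft₀ k hk.ne') volume =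
      volume := by
    simpa [abs_of_pos hk] using Real.smul_map_volume_mul_left hk.ne'
  have h := (MeasurableEquiv.mulLeft₀ k hk.ne').measurableEmbedding.eLpNorm_map_measure
    (μ := volume) (p := q) (g := fun u => H (Real.exp u))
  rw [haarNorm, ← hvol, eLpNorm_smul_measure_of_ne_zero (by simpa using hk), h, haarNorm]
  simp [Function.comp_def, ← Real.exp_mul, mul_comm]

theorem weightedNorm_comp_rpow {k : ℝ} (hk : 0 < k) (r : ℝ) (q : ℝ≥0∞) (b : ℝ → ℝ)
    (φ : ℝ → ℝ≥0∞) :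
    weightedNorm (r / k) q (fun t => b (t ^ (1 / k))) φ = ENNReal.ofReal k ^ (q⁻¹).toReal *
      haarNorm q (fun t => ENNReal.ofReal (t ^ r * b t) * φ (t ^ k)) := by
  rw [weightedNorm_eq_haarNorm, haarNorm_comp_rpow hk]
  congr 1
  refine haarNorm_congr fun t ht => ?_
  rw [← Real.rpow_mul ht.le, ← Real.rpow_mul ht.le, mul_div_cancel₀ _ hk.ne',
    mul_one_div_cancel hk.ne', Real.rpow_one]

theorem haarNorm_iSup_pow_mul_comp_const_mul_le {ρ : ℝ≥0∞} (hρ : ρ < 1) (q : ℝ≥0∞) {c : ℕ → ℝ}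
    (hc : ∀ j, 0 < c j) :
    ∃ C : ℝ≥0, ∀ H : ℝ → ℝ≥0∞, AEMeasurable H (volume.restrict (Ioi 0)) →
      haarNorm q (fun t => ⨆ j, ρ ^ j * H (c j * t)) ≤ C * haarNorm q H := by
  obtain ⟨C, hC⟩ := eLpNorm_iSup_pow_mul_le (ν := (volume : Measure ℝ)) hρ q
  refine ⟨C, fun H hH => hC (fun j u => H (c j * Real.exp u)) _ (fun j => ?_)
    fun j => (haarNorm_comp_const_mul (hc j) q H).le⟩
  have h := (hH.comp_quasiMeasurePreserving quasiMeasurePreserving_exp).comp_quasiMeasurePreserving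
    (measurePreserving_add_left (volume : Measure ℝ) (Real.log (c j))).quasiMeasurePreserving
  simpa only [Function.comp_def, Real.exp_add, Real.exp_log (hc j)] using h

theorem rpow_mul_le_weightedNorm_top {φ : ℝ → ℝ≥0∞} (hφ : Antitone φ) (r : ℝ) {t : ℝ}
    (ht : 0 < t) : ENNReal.ofReal (t ^ r) * φ t ≤ weightedNorm r ∞ (fun _ => 1) φ := by
  rw [weightedNorm_eq_haarNorm, haarNorm, eLpNorm_exponent_top]
  set N := eLpNormEssSup (fun u => ENNReal.ofReal (Real.exp u ^ r * 1) * φ (Real.exp u)) volume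
  have hdense : Dense {u | ENNReal.ofReal (Real.exp u ^ r * 1) * φ (Real.exp u) ≤ N} :=
    Measure.dense_of_ae ae_le_eLpNormEssSup
  have hleft : ∃ᶠ u in nhdsWithin (Real.log t) (Iio (Real.log t)),
      ENNReal.ofReal (Real.exp u ^ r) * φ t ≤ N := by
    rw [frequently_nhdsWithin_iff]
    have hcl : Real.log t ∈ closure (Iio (Real.log t) ∩ _) :=
      closure_minimal (hdense.open_subset_closure_inter isOpen_Iio) isClosed_closure
        (by simp : Real.log t ∈ closure (Iio (Real.log t)))
    refine (mem_closure_iff_frequently.1 hcl).mono fun u ⟨hut, hu⟩ => ⟨?_, hut⟩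
    refine le_trans ?_ hu
    rw [mul_one]
    gcongr
    exact hφ ((Real.lt_log_iff_exp_lt ht).1 hut).le
  refine le_of_tendsto_of_frequently ?_ hleft
  have hcont : ContinuousAt (fun u => ENNReal.ofReal (Real.exp u ^ r)) (Real.log t) :=
    ENNReal.continuous_ofReal.continuousAt.comp
      (Real.continuous_exp.continuousAt.rpow_const (Or.inl (Real.exp_pos _).ne'))
  rw [ContinuousAt, Real.exp_log ht] at hcont
  exact ENNReal.Tendsto.mul_const (hcont.mono_left nhdsWithin_le_nhds)
    (Or.inl (by simpa using Real.rpow_pos_of_pos ht r))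

end HaarNorm

namespace Space

variable {X : Type*}

theorem Embeds.refl (A : Space X) : A.Embeds A :=
  ⟨Subset.rfl, 1, fun f _ => by simp⟩

theorem Embeds.trans {A B C : Space X} (h₁ : A.Embeds B) (h₂ : B.Embeds C) : A.Embeds C := by
  obtain ⟨hAB, c₁, h₁⟩ := h₁
  obtain ⟨hBC, c₂, h₂⟩ := h₂
  refine ⟨hAB.trans hBC, c₂ * c₁, fun f hf => (h₂ f (hAB hf)).trans ?_⟩
  rw [ENNReal.coe_mul, mul_assoc]
  exact mul_le_mul_right (h₁ f hf) _

theorem ofNorm_embeds_ofNorm {N N' : X → ℝ≥0∞} {C : ℝ≥0} (h : ∀ f, N' f ≤ C * N f) :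
    (ofNorm N).Embeds (ofNorm N') :=
  ⟨fun f hf => (h f).trans_lt (ENNReal.mul_lt_top ENNReal.coe_lt_top hf), C, fun f _ => h f⟩

theorem ofNorm_same_of_eq_mul {N N' : X → ℝ≥0∞} {c : ℝ≥0} (hc : c ≠ 0)
    (h : ∀ f, N' f = c * N f) : (ofNorm N).Same (ofNorm N') := by
  refine ⟨ofNorm_embeds_ofNorm fun f => (h f).le, ofNorm_embeds_ofNorm (C := c⁻¹) fun f => ?_⟩
  rw [h, ← mul_assoc, ← ENNReal.coe_mul, inv_mul_cancel₀ hc, ENNReal.coe_one, one_mul]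

variable [Add X] {A₀ A₁ B₀ B₁ : Space X} {t : ℝ}

theorem K_le {f₀ f₁ : X} (h₀ : f₀ ∈ A₀.carrier) (h₁ : f₁ ∈ A₁.carrier) (t : ℝ) :
    K A₀ A₁ t (f₀ + f₁) ≤ A₀.qnorm f₀ + ENNReal.ofReal t * A₁.qnorm f₁ :=
  iInf₂_le_of_le f₀ h₀ <| iInf₂_le_of_le f₁ h₁ <| iInf_le_of_le rfl le_rfl

theorem K_ofNorm_le (N₀ N₁ : X → ℝ≥0∞) (ht : 0 < t) (f₀ f₁ : X) :
    K (ofNorm N₀) (ofNorm N₁) t (f₀ + f₁) ≤ N₀ f₀ + ENNReal.ofReal t * N₁ f₁ := by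
  rcases eq_or_ne (N₀ f₀) ∞ with h₀ | h₀
  · simp [h₀]
  rcases eq_or_ne (N₁ f₁) ∞ with h₁ | h₁
  · simp [h₁, ENNReal.mul_top, ht]
  exact K_le (A₀ := ofNorm N₀) (A₁ := ofNorm N₁) h₀.lt_top h₁.lt_top t

theorem le_K {f : X} {x : ℝ≥0∞} (h : ∀ f₀ ∈ A₀.carrier, ∀ f₁ ∈ A₁.carrier, f = f₀ + f₁ →
    x ≤ A₀.qnorm f₀ + ENNReal.ofReal t * A₁.qnorm f₁) : x ≤ K A₀ A₁ t f :=
  le_iInf₂ fun f₀ h₀ => le_iInf₂ fun f₁ h₁ => le_iInf (h f₀ h₀ f₁ h₁)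

theorem exists_eq_add_of_K_lt_top {f : X} (h : K A₀ A₁ t f < ∞) :
    ∃ f₀ ∈ A₀.carrier, ∃ f₁ ∈ A₁.carrier, f = f₀ + f₁ := by
  simp only [K, iInf_lt_iff] at h
  obtain ⟨f₀, h₀, f₁, h₁, hf, -⟩ := h
  exact ⟨f₀, h₀, f₁, h₁, hf⟩

theorem Embeds.exists_K_le (h₀ : A₀.Embeds B₀) (h₁ : A₁.Embeds B₁) :
    ∃ C : ℝ≥0, ∀ t f, K B₀ B₁ t f ≤ C * K A₀ A₁ t f := by
  obtain ⟨hs₀, c₀, h₀⟩ := h₀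
  obtain ⟨hs₁, c₁, h₁⟩ := h₁
  have hC : ((c₀ + c₁ + 1 : ℝ≥0) : ℝ≥0∞) ≠ 0 := by simp
  have hc₀ : (c₀ : ℝ≥0∞) ≤ (c₀ + c₁ + 1 : ℝ≥0) := by
    exact_mod_cast (le_self_add.trans le_self_add : c₀ ≤ c₀ + c₁ + 1)
  have hc₁ : (c₁ : ℝ≥0∞) ≤ (c₀ + c₁ + 1 : ℝ≥0) := by
    exact_mod_cast (le_add_self.trans le_self_add : c₁ ≤ c₀ + c₁ + 1)
  refine ⟨c₀ + c₁ + 1, fun t f => ?_⟩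
  rw [mul_comm, ← ENNReal.div_le_iff_le_mul (Or.inl hC) (Or.inl ENNReal.coe_ne_top)]
  refine le_K fun f₀ hf₀ f₁ hf₁ hf => ?_
  rw [ENNReal.div_le_iff_le_mul (Or.inl hC) (Or.inl ENNReal.coe_ne_top), mul_comm, hf, mul_add,
    mul_left_comm]
  refine (K_le (hs₀ hf₀) (hs₁ hf₁) t).trans ?_
  gcongr
  · exact (h₀ f₀ hf₀).trans (mul_le_mul_left hc₀ _)
  · exact (h₁ f₁ hf₁).trans (mul_le_mul_left hc₁ _)

theorem Embeds.interp (h₀ : A₀.Embeds B₀) (h₁ : A₁.Embeds B₁) (θ : ℝ) (q : ℝ≥0∞) (a : ℝ → ℝ) :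
    (interp A₀ A₁ θ q a).Embeds (interp B₀ B₁ θ q a) := by
  obtain ⟨C, hK⟩ := h₀.exists_K_le h₁
  have hN (f : X) : interpNorm B₀ B₁ θ q a f ≤ C * interpNorm A₀ A₁ θ q a f := by
    simp only [interpNorm, weightedNorm_eq_haarNorm]
    refine haarNorm_le_mul_of_le fun t _ => ?_
    rw [mul_left_comm]
    exact mul_le_mul_right (hK t f) _
  refine ⟨?_, C, fun f _ => hN f⟩
  rintro f ⟨⟨f₀, hf₀, f₁, hf₁, hf⟩, hfin⟩
  exact ⟨⟨f₀, h₀.1 hf₀, f₁, h₁.1 hf₁, hf⟩,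
    (hN f).trans_lt (ENNReal.mul_lt_top ENNReal.coe_lt_top hfin)⟩

theorem exists_eq_add_of_interpNorm_lt_top {θ : ℝ} {q : ℝ≥0∞} (hq : q ≠ 0) {a : ℝ → ℝ}
    (ha : ∀ t, 0 < t → 0 < a t) {f : X} (hf : interpNorm A₀ A₁ θ q a f < ∞) :
    ∃ f₀ ∈ A₀.carrier, ∃ f₁ ∈ A₁.carrier, f = f₀ + f₁ := by
  rw [interpNorm, weightedNorm_eq_haarNorm] at hf
  obtain ⟨u, hu⟩ := exists_lt_top_of_eLpNorm_lt_top hq hf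
  have hweight : 0 < Real.exp u ^ (-θ) * a (Real.exp u) :=
    mul_pos (by positivity) (ha _ u.exp_pos)
  exact exists_eq_add_of_K_lt_top
    (ENNReal.lt_top_of_mul_ne_top_right hu.ne (by simpa using hweight))

theorem interp_embeds_ofNorm {θ : ℝ} {q : ℝ≥0∞} {a : ℝ → ℝ} {N : X → ℝ≥0∞} {C : ℝ≥0}
    (h : ∀ f, N f ≤ C * interpNorm A₀ A₁ θ q a f) : (interp A₀ A₁ θ q a).Embeds (ofNorm N) :=
  ⟨fun f hf => (h f).trans_lt (ENNReal.mul_lt_top ENNReal.coe_lt_top hf.2), C, fun f _ => h f⟩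

theorem ofNorm_embeds_interp {θ : ℝ} {q : ℝ≥0∞} (hq : q ≠ 0) {a : ℝ → ℝ}
    (ha : ∀ t, 0 < t → 0 < a t) {N : X → ℝ≥0∞} {C : ℝ≥0}
    (h : ∀ f, interpNorm A₀ A₁ θ q a f ≤ C * N f) : (ofNorm N).Embeds (interp A₀ A₁ θ q a) := by
  refine ⟨fun f hf => ?_, C, fun f _ => h f⟩
  have hfin := (h f).trans_lt (ENNReal.mul_lt_top ENNReal.coe_lt_top hf)
  exact ⟨exists_eq_add_of_interpNorm_lt_top hq ha hfin, hfin⟩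

end Space

section Rearrangement

variable {Ω 𝕜 : Type*} [RCLike 𝕜] [MeasurableSpace Ω] {μ : Measure Ω}

theorem rearrangement_antitone (f : Ω →ₘ[μ] 𝕜) : Antitone (rearrangement f) :=
  fun _ _ h => sInf_le_sInf fun _ hs => le_trans hs (ENNReal.ofReal_le_ofReal h)

theorem ofReal_lt_measure_of_lt_rearrangement {f : Ω →ₘ[μ] 𝕜} {t : ℝ} {s : ℝ≥0∞}
    (h : s < rearrangement f t) : ENNReal.ofReal t < μ {x | s < ‖f x‖ₑ} :=
  not_le.1 fun hle => h.not_ge (sInf_le hle)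

theorem measure_rearrangement_lt_le (f : Ω →ₘ[μ] 𝕜) (t : ℝ) :
    μ {x | rearrangement f t < ‖f x‖ₑ} ≤ ENNReal.ofReal t := by
  obtain ⟨u, hu, hlim, hmem⟩ := exists_seq_tendsto_sInf
    (S := {s : ℝ≥0∞ | μ {x | s < ‖f x‖ₑ} ≤ ENNReal.ofReal t}) ⟨∞, by simp⟩ (OrderBot.bddBelow _)
  have hsub : {x | rearrangement f t < ‖f x‖ₑ} ⊆ ⋃ n, {x | u n < ‖f x‖ₑ} := fun x hx =>
    mem_iUnion.2 (hlim.eventually_lt_const hx).exists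
  have hmono : Monotone fun n => {x | u n < ‖f x‖ₑ} := fun m n hmn x hx => (hu hmn).trans_lt hx
  refine (measure_mono hsub).trans ?_
  rw [hmono.measure_iUnion]
  exact iSup_le hmem

theorem rearrangement_add_le (f g : Ω →ₘ[μ] 𝕜) (t : ℝ) :
    rearrangement (f + g) t ≤ rearrangement f t + eLpNorm g ∞ μ := by
  refine sInf_le (le_trans (measure_mono_ae ?_) (measure_rearrangement_lt_le f t))
  filter_upwards [AEEqFun.coeFn_add f g, ae_le_eLpNormEssSup (f := g) (μ := μ)] with x hx hg hlt
  have hlt : rearrangement f t + eLpNorm g ∞ μ < ‖f x + g x‖ₑ := by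
    rw [← Pi.add_apply, ← hx]
    exact hlt
  refine lt_of_not_ge fun hle => hlt.not_ge ?_
  exact (enorm_add_le _ _).trans (add_le_add hle hg)

theorem rpow_mul_rearrangement_le_eLpNorm {k : ℝ} (hk : 0 < k) (f : Ω →ₘ[μ] 𝕜) {t : ℝ}
    (ht : 0 < t) :
    ENNReal.ofReal (t ^ (1 / k)) * rearrangement f t ≤ eLpNorm f (ENNReal.ofReal k) μ := by
  refine ENNReal.mul_le_of_forall_lt fun a ha s hs => ?_
  refine (mul_le_mul_left ha.le s).trans ?_
  have hmarkov := mul_meas_ge_le_pow_eLpNorm' μ (p := ENNReal.ofReal k) (by simpa using hk)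
    ENNReal.ofReal_ne_top f.aestronglyMeasurable s
  rw [ENNReal.toReal_ofReal hk.le] at hmarkov
  rw [← ENNReal.rpow_le_rpow_iff hk]
  calc (ENNReal.ofReal (t ^ (1 / k)) * s) ^ k = s ^ k * ENNReal.ofReal t := by
        rw [ENNReal.mul_rpow_of_nonneg _ _ hk.le, ENNReal.ofReal_rpow_of_nonneg (by positivity)
          hk.le, one_div, Real.rpow_inv_rpow ht.le hk.ne', mul_comm]
    _ ≤ s ^ k * μ {x | s ≤ ‖f x‖ₑ} := by
        gcongr
        exact (ofReal_lt_measure_of_lt_rearrangement hs).le.trans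
          (measure_mono fun x hx => LT.lt.le (a := s) hx)
    _ ≤ eLpNorm f (ENNReal.ofReal k) μ ^ k := hmarkov

end Rearrangement

section KFunctional

variable {Ω 𝕜 : Type*} [RCLike 𝕜] [MeasurableSpace Ω] {μ : Measure Ω} {k : ℝ}

theorem lorentzSpace_top_qnorm (hk : 0 < k) (f : Ω →ₘ[μ] 𝕜) :
    (lorentzSpace 𝕜 μ (ENNReal.ofReal k) ∞).qnorm f =
      weightedNorm (1 / k) ∞ (fun _ => 1) (rearrangement f) := by
  rw [lorentzSpace, lorentzKaramata, Space.ofNorm, ENNReal.toReal_inv, ENNReal.toReal_ofReal hk.le,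
    one_div]

theorem lebesgueSpace_embeds_lorentzSpace_top (hk : 0 < k) :
    (lebesgueSpace 𝕜 μ (ENNReal.ofReal k)).Embeds (lorentzSpace 𝕜 μ (ENNReal.ofReal k) ∞) := by
  refine Space.ofNorm_embeds_ofNorm (C := 1) fun f => ?_
  refine (lorentzSpace_top_qnorm hk f).trans_le ?_
  rw [weightedNorm_eq_haarNorm, haarNorm, eLpNorm_exponent_top, ENNReal.coe_one, one_mul]
  refine essSup_le_of_ae_le _ (.of_forall fun u => ?_)
  simp only [enorm_eq_self, mul_one]
  exact rpow_mul_rearrangement_le_eLpNorm hk f u.exp_pos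

theorem mul_rearrangement_rpow_le_lorentzSpace_top_qnorm (hk : 0 < k) (f : Ω →ₘ[μ] 𝕜) {t : ℝ}
    (ht : 0 < t) :
    ENNReal.ofReal t * rearrangement f (t ^ k) ≤
      (lorentzSpace 𝕜 μ (ENNReal.ofReal k) ∞).qnorm f := by
  have h := rpow_mul_le_weightedNorm_top (rearrangement_antitone f) (1 / k)
    (Real.rpow_pos_of_pos ht k)
  rwa [one_div, Real.rpow_rpow_inv ht.le hk.ne', ← one_div, ← lorentzSpace_top_qnorm hk] at h

theorem mul_rearrangement_rpow_le_K (hk : 0 < k) (f : Ω →ₘ[μ] 𝕜) {t : ℝ} (ht : 0 < t) :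
    ENNReal.ofReal t * rearrangement f (t ^ k) ≤
      Space.K (lorentzSpace 𝕜 μ (ENNReal.ofReal k) ∞) (lebesgueSpace 𝕜 μ ∞) t f := by
  refine Space.le_K ?_
  rintro f₀ - f₁ - rfl
  calc ENNReal.ofReal t * rearrangement (f₀ + f₁) (t ^ k)
      ≤ ENNReal.ofReal t * (rearrangement f₀ (t ^ k) + eLpNorm f₁ ∞ μ) :=
        mul_le_mul_right (rearrangement_add_le f₀ f₁ _) _
    _ = ENNReal.ofReal t * rearrangement f₀ (t ^ k) + ENNReal.ofReal t * eLpNorm f₁ ∞ μ :=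
        mul_add _ _ _
    _ ≤ _ := add_le_add_left (mul_rearrangement_rpow_le_lorentzSpace_top_qnorm hk f₀ ht) _

theorem K_lebesgueSpace_top_le (r : ℝ≥0∞) (f : Ω →ₘ[μ] 𝕜) {t : ℝ} (ht : 0 < t) (l : ℝ≥0∞) :
    Space.K (lebesgueSpace 𝕜 μ r) (lebesgueSpace 𝕜 μ ∞) t f ≤
      eLpNorm f r (μ.restrict {x | l < ‖f x‖ₑ}) + ENNReal.ofReal t * l := by
  set A : Set Ω := {x | l < ‖f x‖ₑ}
  have hA : MeasurableSet A := measurableSet_lt measurable_const f.measurable.enorm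
  have h₀ : AEStronglyMeasurable (A.indicator f) μ := f.aestronglyMeasurable.indicator hA
  have h₁ : AEStronglyMeasurable (Aᶜ.indicator f) μ := f.aestronglyMeasurable.indicator hA.compl
  have hf : f = AEEqFun.mk _ h₀ + AEEqFun.mk _ h₁ := by
    simp only [AEEqFun.mk_add_mk, indicator_self_add_compl, AEEqFun.mk_coeFn]
  have hbdd : eLpNorm (AEEqFun.mk _ h₁) ∞ μ ≤ l := by
    rw [eLpNorm_congr_ae (AEEqFun.coeFn_mk _ h₁), eLpNorm_exponent_top]
    refine essSup_le_of_ae_le _ (.of_forall fun x => ?_)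
    by_cases hx : x ∈ A
    · simp [hx]
    · simpa [hx] using not_lt.1 hx
  rw [← eLpNorm_indicator_eq_eLpNorm_restrict hA, ← eLpNorm_congr_ae (AEEqFun.coeFn_mk _ h₀)]
  conv_lhs => rw [hf]
  exact (Space.K_ofNorm_le _ _ ht _ _).trans (by gcongr)

theorem measure_forall_rearrangement_lt_eq_zero (hk : 0 < k) (f : Ω →ₘ[μ] 𝕜) (t : ℝ) :
    μ {x | ∀ j : ℕ, rearrangement f (((1 / 2) ^ j * t) ^ k) < ‖f x‖ₑ} = 0 := by
  have hlim : Filter.Tendsto (fun j : ℕ => ENNReal.ofReal (((1 / 2 : ℝ) ^ j * t) ^ k))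
      Filter.atTop (nhds 0) := by
    have h := (tendsto_pow_atTop_nhds_zero_of_lt_one (r := (1 / 2 : ℝ)) (by norm_num)
      (by norm_num)).mul_const t
    simpa [Real.zero_rpow hk.ne'] using ENNReal.tendsto_ofReal (h.rpow_const (Or.inr hk.le))
  refine le_antisymm (ge_of_tendsto' hlim fun j => ?_) zero_le
  refine le_trans (measure_mono ?_) (measure_rearrangement_lt_le f _)
  exact fun x hx => hx j

theorem eLpNorm_restrict_rearrangement_lt_rpow_le (hk : 0 < k) (f : Ω →ₘ[μ] 𝕜) {t : ℝ}
    (ht : 0 < t) :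
    eLpNorm f (ENNReal.ofReal k) (μ.restrict {x | rearrangement f (t ^ k) < ‖f x‖ₑ}) ^ k ≤
      ∑' j : ℕ, (ENNReal.ofReal ((1 / 2) ^ j * t) *
        rearrangement f (((1 / 2) ^ (j + 1) * t) ^ k)) ^ k := by
  have hlayers := setLIntegral_rpow_le_tsum_superlevel f.measurable.enorm hk.le
    (measure_forall_rearrangement_lt_eq_zero hk f t)
  rw [pow_zero, one_mul] at hlayers
  rw [eLpNorm_eq_lintegral_rpow_enorm_toReal (by simpa using hk) ENNReal.ofReal_ne_top,
    ENNReal.toReal_ofReal hk.le, one_div, ENNReal.rpow_inv_rpow hk.ne']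
  refine hlayers.trans (ENNReal.tsum_le_tsum fun j => ?_)
  rw [ENNReal.mul_rpow_of_nonneg _ _ hk.le, ENNReal.ofReal_rpow_of_nonneg (by positivity) hk.le,
    mul_comm]
  exact mul_le_mul_left (measure_rearrangement_lt_le f _) _

theorem exists_mul_K_lebesgueSpace_le_of_dyadic (hk : 0 < k) {ρ : ℝ≥0∞} (hρ : ρ < 1) :
    ∃ C : ℝ≥0, ∀ (f : Ω →ₘ[μ] 𝕜) (t : ℝ) (w S : ℝ≥0∞), 0 < t →
      (∀ j : ℕ, w * (ENNReal.ofReal ((1 / 2) ^ j * t) *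
        rearrangement f (((1 / 2) ^ (j + 1) * t) ^ k)) ≤ ρ ^ j * S) →
      w * Space.K (lebesgueSpace 𝕜 μ (ENNReal.ofReal k)) (lebesgueSpace 𝕜 μ ∞) t f ≤ C * S := by
  have hD := tsum_rpow_pow_ne_top hρ hk
  set D := ∑' j : ℕ, (ρ ^ j) ^ k
  refine ⟨(D ^ (1 / k)).toNNReal + 1, fun f t w S ht hS => ?_⟩
  have hlarge : w * eLpNorm f (ENNReal.ofReal k)
      (μ.restrict {x | rearrangement f (t ^ k) < ‖f x‖ₑ}) ≤ D ^ (1 / k) * S := by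
    rw [← ENNReal.rpow_le_rpow_iff hk, ENNReal.mul_rpow_of_nonneg _ _ hk.le,
      ENNReal.mul_rpow_of_nonneg _ _ hk.le, one_div, ENNReal.rpow_inv_rpow hk.ne']
    refine (mul_le_mul_right (eLpNorm_restrict_rearrangement_lt_rpow_le hk f ht) _).trans ?_
    simp only [← ENNReal.tsum_mul_left, ← ENNReal.mul_rpow_of_nonneg _ _ hk.le]
    exact tsum_rpow_le_of_le_pow_mul hk.le hS
  have hsmall : w * (ENNReal.ofReal t * rearrangement f (t ^ k)) ≤ S := by
    refine le_trans ?_ (by simpa using hS 0)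
    gcongr
    exact rearrangement_antitone f (Real.rpow_le_rpow (by positivity) (by linarith) hk.le)
  calc _ ≤ _ := mul_le_mul_right (K_lebesgueSpace_top_le _ f ht (rearrangement f (t ^ k))) w
    _ ≤ D ^ (1 / k) * S + S := (mul_add _ _ _).trans_le (add_le_add hlarge hsmall)
    _ = _ := by
      rw [ENNReal.coe_add, ENNReal.coe_one,
        ENNReal.coe_toNNReal (ENNReal.rpow_ne_top_of_nonneg (by positivity) hD), add_mul, one_mul]

end KFunctional

section Growth

/-- `b` grows at most like the power `t ^ ε` under dilations, that is, `t ^ (-ε) * b t` is almost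
decreasing on `(0, ∞)`. -/
def HasUpperGrowth (ε : ℝ) (b : ℝ → ℝ) : Prop :=
  ∃ C : ℝ, 0 < C ∧ ∀ l t : ℝ, 1 ≤ l → 0 < t → b (l * t) ≤ C * l ^ ε * b t

theorem SlowlyVarying.hasUpperGrowth {b : ℝ → ℝ} (hb : SlowlyVarying b) {ε : ℝ} (hε : 0 < ε) :
    HasUpperGrowth ε b := by
  obtain ⟨g, hg, C, hC, h⟩ := hb.decreasing ε hε
  refine ⟨C * C, by positivity, fun l t hl ht => ?_⟩
  have hl₀ : 0 < l := one_pos.trans_le hl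
  have hlt : 0 < l * t := by positivity
  have hdec : (l * t) ^ (-ε) * b (l * t) ≤ C * (C * (t ^ (-ε) * b t)) :=
    (h _ hlt).1.trans <| mul_le_mul_of_nonneg_left
      ((hg ht hlt (le_mul_of_one_le_left ht.le hl)).trans (h t ht).2) hC.le
  calc b (l * t) = (l * t) ^ ε * ((l * t) ^ (-ε) * b (l * t)) := by
        rw [← mul_assoc, ← Real.rpow_add hlt, add_neg_cancel, Real.rpow_zero, one_mul]
    _ ≤ (l * t) ^ ε * (C * (C * (t ^ (-ε) * b t))) := by gcongr
    _ = C * C * l ^ ε * (t ^ ε * t ^ (-ε)) * b t := by rw [Real.mul_rpow hl₀.le ht.le]; ring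
    _ = C * C * l ^ ε * b t := by
        rw [← Real.rpow_add ht, add_neg_cancel, Real.rpow_zero, mul_one]

theorem HasUpperGrowth.exists_dyadic_le {ε : ℝ} {b : ℝ → ℝ} (hb : HasUpperGrowth ε b) (θ : ℝ) :
    ∃ A : ℝ, 0 < A ∧ ∀ (j : ℕ) (t : ℝ), 0 < t →
      t ^ (-θ) * b t * ((1 / 2) ^ j * t) ≤ A * ((2 ^ (ε - θ)) ^ j *
        (((1 / 2) ^ (j + 1) * t) ^ (1 - θ) * b ((1 / 2) ^ (j + 1) * t))) := by
  obtain ⟨C, hC, h⟩ := hb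
  refine ⟨2 * (C * 2 ^ (ε - θ)), by positivity, fun j t ht => ?_⟩
  set s : ℝ := (1 / 2) ^ (j + 1) * t
  set l : ℝ := 2 ^ (j + 1)
  have hs : 0 < s := by positivity
  have hl : 0 < l := by positivity
  have hts : t = l * s := by rw [← mul_assoc, ← mul_pow]; norm_num
  have hhalf : (1 / 2) ^ j * t = 2 * s := by rw [← mul_assoc, pow_succ]; ring
  calc t ^ (-θ) * b t * ((1 / 2) ^ j * t) ≤ t ^ (-θ) * (C * l ^ ε * b s) * (2 * s) := by
        rw [hhalf]
        gcongr
        rw [hts]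
        exact h l s (one_le_pow₀ one_le_two) hs
    _ = 2 * C * (l ^ ε * l ^ (-θ)) * (s ^ (-θ) * s ^ (1 : ℝ) * b s) := by
        rw [hts, Real.mul_rpow hl.le hs.le, Real.rpow_one]; ring
    _ = 2 * C * l ^ (ε - θ) * (s ^ (1 - θ) * b s) := by
        rw [← Real.rpow_add hl, ← Real.rpow_add hs, ← sub_eq_add_neg, neg_add_eq_sub]
    _ = _ := by rw [← Real.rpow_pow_comm zero_le_two, pow_succ]; ring

end Growth

section Interpolation

variable {Ω 𝕜 : Type*} [RCLike 𝕜] [MeasurableSpace Ω] {μ : Measure Ω}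

/-- The function on `(0, ∞)` whose norm in `L_q(dt/t)` is, up to a constant factor, the quasi-norm
of `f` in `L_{p,q;a}`, `1/p = (1 - θ)/k`, `a t = b (t ^ (1 / k))`: the substitution `t ↦ t ^ k`
turns the weight of that space into the one of the interpolation spaces with parameters `θ`, `b`. -/
def substProfile (θ k : ℝ) (b : ℝ → ℝ) (f : Ω →ₘ[μ] 𝕜) (t : ℝ) : ℝ≥0∞ :=
  ENNReal.ofReal (t ^ (1 - θ) * b t) * rearrangement f (t ^ k)

theorem ofNorm_substProfile_same_lorentzKaramata {k : ℝ} (hk : 0 < k) {θ : ℝ} {p : ℝ≥0∞}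
    (hp : (p⁻¹).toReal = (1 - θ) / k) (q : ℝ≥0∞) (b : ℝ → ℝ) :
    (Space.ofNorm fun f : Ω →ₘ[μ] 𝕜 => haarNorm q (substProfile θ k b f)).Same
      (lorentzKaramata 𝕜 μ p q fun t => b (t ^ (1 / k))) := by
  have hc : k.toNNReal ^ (q⁻¹).toReal ≠ 0 := by positivity
  refine Space.ofNorm_same_of_eq_mul hc fun f => ?_
  rw [hp, weightedNorm_comp_rpow hk, ENNReal.coe_rpow_of_nonneg _ (by positivity)]
  rfl

theorem interp_lorentzSpace_top_embeds_ofNorm_substProfile {k : ℝ} (hk : 0 < k) (θ : ℝ) (q : ℝ≥0∞)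
    (b : ℝ → ℝ) :
    (Space.interp (lorentzSpace 𝕜 μ (ENNReal.ofReal k) ∞) (lebesgueSpace 𝕜 μ ∞) θ q b).Embeds
      (Space.ofNorm fun f => haarNorm q (substProfile θ k b f)) := by
  refine Space.interp_embeds_ofNorm (C := 1) fun f => ?_
  rw [Space.interpNorm, weightedNorm_eq_haarNorm]
  refine haarNorm_le_mul_of_le fun t ht => ?_
  calc _ = ENNReal.ofReal (t ^ (-θ) * b t) * (ENNReal.ofReal t * rearrangement f (t ^ k)) := by
        rw [substProfile, ← mul_assoc, ← ENNReal.ofReal_mul' ht.le, sub_eq_neg_add,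
          Real.rpow_add_one ht.ne', mul_right_comm]
    _ ≤ _ := mul_le_mul_right (mul_rearrangement_rpow_le_K hk f ht) _
    _ = _ := (one_mul _).symm

theorem exists_mul_K_lebesgueSpace_le_iSup {k : ℝ} (hk : 0 < k) {θ ε : ℝ} (hε : ε < θ)
    {b : ℝ → ℝ} (hpos : ∀ t, 0 < t → 0 < b t) (hb : HasUpperGrowth ε b) :
    ∃ ρ < (1 : ℝ≥0∞), ∃ C : ℝ≥0, ∀ (f : Ω →ₘ[μ] 𝕜) (t : ℝ), 0 < t →
      ENNReal.ofReal (t ^ (-θ) * b t) *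
          Space.K (lebesgueSpace 𝕜 μ (ENNReal.ofReal k)) (lebesgueSpace 𝕜 μ ∞) t f ≤
        C * ⨆ j : ℕ, ρ ^ j * substProfile θ k b f ((1 / 2) ^ (j + 1) * t) := by
  -- The decay `2 ^ (ε - θ) = ρ ^ 2` is split: one factor `ρ` makes the dyadic sum in the bound for
  -- `K` converge, the other one is kept in the supremum.
  set ρ : ℝ≥0∞ := ENNReal.ofReal (2 ^ ((ε - θ) / 2))
  have hρ : ρ < 1 := by
    rw [ENNReal.ofReal_lt_one]
    exact Real.rpow_lt_one_of_one_lt_of_neg one_lt_two (by linarith)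
  have hρ₂ : ENNReal.ofReal (2 ^ (ε - θ)) = ρ * ρ := by
    rw [← ENNReal.ofReal_mul (by positivity), ← Real.rpow_add two_pos, add_halves]
  obtain ⟨A, hA₀, hA⟩ := hb.exists_dyadic_le θ
  obtain ⟨C, hC⟩ := exists_mul_K_lebesgueSpace_le_of_dyadic (𝕜 := 𝕜) (μ := μ) hk hρ
  refine ⟨ρ, hρ, C * A.toNNReal, fun f t ht => ?_⟩
  rw [ENNReal.coe_mul, mul_assoc]
  refine hC f t _ _ ht fun j => ?_
  have hw : 0 < t ^ (-θ) * b t := mul_pos (by positivity) (hpos t ht)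
  set s := (1 / 2) ^ (j + 1) * t
  calc _ = ENNReal.ofReal (t ^ (-θ) * b t * ((1 / 2) ^ j * t)) * rearrangement f (s ^ k) := by
        rw [ENNReal.ofReal_mul hw.le, mul_assoc]
    _ ≤ _ := mul_le_mul_left (ENNReal.ofReal_le_ofReal (hA j t ht)) _
    _ = ρ ^ j * (A.toNNReal * (ρ ^ j * substProfile θ k b f s)) := by
        rw [ENNReal.ofReal_mul hA₀.le, ENNReal.ofReal_mul (by positivity),
          ENNReal.ofReal_pow (by positivity), hρ₂, ENNReal.ofReal, mul_pow, substProfile]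
        ring
    _ ≤ _ := by
        gcongr
        exact le_iSup (fun i : ℕ => ρ ^ i * substProfile θ k b f ((1 / 2) ^ (i + 1) * t)) j

theorem aemeasurable_substProfile {θ k : ℝ} {b : ℝ → ℝ}
    (hb : AEMeasurable b (volume.restrict (Ioi 0))) (f : Ω →ₘ[μ] 𝕜) :
    AEMeasurable (substProfile θ k b f) (volume.restrict (Ioi 0)) := by
  have hrearr : Measurable fun t : ℝ => rearrangement f (t ^ k) :=
    (rearrangement_antitone f).measurable.comp (by fun_prop)
  have hweight : AEMeasurable (fun t => t ^ (1 - θ) * b t) (volume.restrict (Ioi 0)) :=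
    AEMeasurable.mul (by fun_prop) hb
  exact hweight.ennreal_ofReal.mul hrearr.aemeasurable

theorem ofNorm_substProfile_embeds_interp_lebesgueSpace {k : ℝ} (hk : 0 < k) {θ ε : ℝ}
    (hε : ε < θ) {q : ℝ≥0∞} (hq : q ≠ 0) {b : ℝ → ℝ}
    (hmeas : AEMeasurable b (volume.restrict (Ioi 0))) (hpos : ∀ t, 0 < t → 0 < b t)
    (hb : HasUpperGrowth ε b) :
    (Space.ofNorm fun f => haarNorm q (substProfile θ k b f)).Embeds
      (Space.interp (lebesgueSpace 𝕜 μ (ENNReal.ofReal k)) (lebesgueSpace 𝕜 μ ∞) θ q b) := by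
  obtain ⟨ρ, hρ, C₁, hK⟩ := exists_mul_K_lebesgueSpace_le_iSup (𝕜 := 𝕜) (μ := μ) hk hε hpos hb
  obtain ⟨C₂, hsup⟩ := haarNorm_iSup_pow_mul_comp_const_mul_le hρ q
    (c := fun j => (1 / 2) ^ (j + 1)) fun j => by positivity
  refine Space.ofNorm_embeds_interp hq hpos (C := C₁ * C₂) fun f => ?_
  rw [Space.interpNorm, weightedNorm_eq_haarNorm, ENNReal.coe_mul, mul_assoc]
  exact (haarNorm_le_mul_of_le (hK f)).trans
    (mul_le_mul_right (hsup _ (aemeasurable_substProfile hmeas f)) _)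

end Interpolation

end LorentzKaramata

end

theorem theorem5p1_general {Ω 𝕜 : Type*} [RCLike 𝕜] [MeasurableSpace Ω] (μ : Measure Ω)
    (θ : ℝ) (hθ₁ : θ ≤ 1) (κ : ℝ) (hκ : 0 < κ)
    (p : ℝ≥0∞) (hp : p = ENNReal.ofReal κ / ENNReal.ofReal (1 - θ))
    (q : ℝ≥0∞) (hq : 0 < q) (b : ℝ → ℝ) (hmeas : AEMeasurable b (volume.restrict (Ioi 0)))
    (hpos : ∀ t, 0 < t → 0 < b t) (ε : ℝ) (hε : ε < θ)
    (hb : LorentzKaramata.HasUpperGrowth ε b) :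
    (LorentzKaramata.Space.interp
        (LorentzKaramata.lebesgueSpace 𝕜 μ (ENNReal.ofReal κ))
        (LorentzKaramata.lebesgueSpace 𝕜 μ ∞) θ q b).Same
      (LorentzKaramata.lorentzKaramata 𝕜 μ p q fun t => b (t ^ (1 / κ))) ∧
    (LorentzKaramata.Space.interp
        (LorentzKaramata.lorentzSpace 𝕜 μ (ENNReal.ofReal κ) ∞)
        (LorentzKaramata.lebesgueSpace 𝕜 μ ∞) θ q b).Same
      (LorentzKaramata.lorentzKaramata 𝕜 μ p q fun t => b (t ^ (1 / κ))) := by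
  have hp' : (p⁻¹).toReal = (1 - θ) / κ := by
    rw [hp, ENNReal.inv_div (Or.inl ENNReal.ofReal_ne_top) (Or.inr (by simpa using hκ)),
      ENNReal.toReal_div, ENNReal.toReal_ofReal (sub_nonneg.2 hθ₁), ENNReal.toReal_ofReal hκ.le]
  have hsubst := LorentzKaramata.ofNorm_substProfile_same_lorentzKaramata (𝕜 := 𝕜) (μ := μ)
    hκ hp' q b
  have hstrong_weak := (LorentzKaramata.lebesgueSpace_embeds_lorentzSpace_top (𝕜 := 𝕜) (μ := μ)
    hκ).interp (.refl (LorentzKaramata.lebesgueSpace 𝕜 μ ∞)) θ q b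
  have hweak := (LorentzKaramata.interp_lorentzSpace_top_embeds_ofNorm_substProfile hκ θ q b).trans
    hsubst.1
  have hstrong := hsubst.2.trans
    (LorentzKaramata.ofNorm_substProfile_embeds_interp_lebesgueSpace hκ hε hq.ne' hmeas hpos hb)
  exact ⟨⟨hstrong_weak.trans hweak, hstrong⟩, hweak, hstrong.trans hstrong_weak⟩

theorem theorem5p1 {Ω 𝕜 : Type*} [RCLike 𝕜] [MeasurableSpace Ω] (μ : Measure Ω) [SigmaFinite μ]
    (hμ : LorentzKaramata.NonAtomic μ)
    (θ : ℝ) (hθ₀ : 0 < θ) (hθ₁ : θ ≤ 1) (κ : ℝ) (hκ : 0 < κ)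
    (p : ℝ≥0∞) (hp : p = ENNReal.ofReal κ / ENNReal.ofReal (1 - θ))
    (q : ℝ≥0∞) (hq : 0 < q) (b : ℝ → ℝ) (hb : LorentzKaramata.SlowlyVarying b) :
    (LorentzKaramata.Space.interp
        (LorentzKaramata.lebesgueSpace 𝕜 μ (ENNReal.ofReal κ))
        (LorentzKaramata.lebesgueSpace 𝕜 μ ∞) θ q b).Same
      (LorentzKaramata.lorentzKaramata 𝕜 μ p q fun t => b (t ^ (1 / κ))) ∧
    (LorentzKaramata.Space.interp
        (LorentzKaramata.lorentzSpace 𝕜 μ (ENNReal.ofReal κ) ∞)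
        (LorentzKaramata.lebesgueSpace 𝕜 μ ∞) θ q b).Same
      (LorentzKaramata.lorentzKaramata 𝕜 μ p q fun t => b (t ^ (1 / κ))) :=
  theorem5p1_general μ θ hθ₁ κ hκ p hp q hq b hb.aemeasurable hb.pos (θ / 2) (half_lt_self hθ₀)
    (hb.hasUpperGrowth (half_pos hθ₀))
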